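/- For a cardinal $\kappa$, a linear order $D$ is $\kappa$-dense if $|D|>1$ and every open interval $(a,b)$ of $D$ with $a<b$ has at least $\kappa$ elements; a linear order (or its order type) is $\kappa$-scattered if none of its suborders is $\kappa$-dense. For a cardinal $\lambda$, an order type $\varphi$ is $\langle\kappa,\lambda\rangle$-scattered if an order of type $\varphi$ is the union of fewer than $\lambda$ suborders, each of which is $\kappa$-scattered. Write $\tau^*$ for the reverse of an order type $\tau$, and $\tau\varphi$ for the lexicographic sum of $\varphi$ many copies of $\tau$ (that is, $\varphi\times\tau$ ordered lexicographically with the $\varphi$-coordinate first); powers $\tau^n$ are taken with respect to this product, with $\tau^0=1$. A cardinal is identified with its initial ordinal, and $\mu^n$ denotes ordinal exponentiation. **Theorem.** Let $\kappa\le\mu$ be infinite regular cardinals, and let $\varphi$ be a $\langle\kappa,\max(\aleph_1,\kappa)\rangle$-scattered linear order type of size at most $\mu$. Then every linear order $P$ of type $\varphi$ can be written as a union $P=\bigcup_{n<\omega}P_n$ such that there is no $n<\omega$ for which $P_n$ has a suborder of type $\mu^n$, $(\mu^n)^*$, $(\kappa\kappa^*)^n$ or $(\kappa^*\kappa)^n$.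 -/

import Mathlib

open Cardinal

universe u

noncomputable section

namespace OrderType

/-- The order type of an ordinal. -/
def ofOrdinal (o : Ordinal.{u}) : OrderType.{u} :=
  type o.ToType

/-- The reverse `φ*` of an order type. -/
def rev (φ : OrderType.{u}) : OrderType.{u} :=
  φ.liftOn (fun α _ => type αᵒᵈ)
    fun _ _ _ _ h => type_congr (type_eq_type.mp h).some.dual

theorem rev_type (α : Type u) [LinearOrder α] : rev (type α) = type αᵒᵈ :=
  liftOn_type _ _

/-- `φ` is `κ`-dense: an order of type `φ` has more than one element, and each of its open
intervals `(a, b)` with `a < b` has at least `κ` elements. -/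
def IsKDense (κ : Cardinal.{u}) (φ : OrderType.{u}) : Prop :=
  ∃ (P : Type u) (_ : LinearOrder P), type P = φ ∧
    1 < #P ∧ ∀ a b : P, a < b → κ ≤ #(Set.Ioo a b)

/-- `φ` is `κ`-scattered: no `κ`-dense order type embeds into `φ`. -/
def IsKScattered (κ : Cardinal.{u}) (φ : OrderType.{u}) : Prop :=
  ¬ ∃ τ : OrderType.{u}, IsKDense κ τ ∧ τ ≤ φ

/-- `φ` is `⟨κ, μ⟩`-scattered: an order of type `φ` is a union of fewer than `μ` suborders
whose types are `κ`-scattered. -/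
def IsPairScattered (κ μ : Cardinal.{u}) (φ : OrderType.{u}) : Prop :=
  ∃ (P : Type u) (_ : LinearOrder P), type P = φ ∧
    ∃ (ι : Type u) (Q : ι → Set P), #ι < μ ∧
      (∀ i, IsKScattered κ (type (Q i))) ∧ (⋃ i, Q i) = Set.univ

/-- The order `P` has a suborder of type `τ`. -/
def HasSuborder (P : Type u) [LinearOrder P] (τ : OrderType.{u}) : Prop :=
  ∃ S : Set P, type S = τ

end OrderType

end

open Set

/-! Call a set coverable if it lies in a union of sets `Q n`, with `Q n` avoiding the `n`-th powers
of the four types. Coverability passes to subsets, to unions of fewer than `κ` sets (by regularity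
the four types are indivisible) and to countable unions (reindex by pairing). It also lifts from the
fibers of a monotone or antitone map into `μ` to the whole set, at the cost of two in the exponent
(`HasAvoidingCover.of_fibers`).

As `P` has at most `μ` points, the lifting shows that a set is coverable once all its initial
pieces, or all its final pieces, are. So the classes of the relation "the interval between the
points is coverable" are themselves coverable. Fewer than `κ` classes strictly between two distinct
ones would make the interval joining them coverable and so identify them. Hence representatives of
the classes, if more than one, form a `κ`-dense suborder. A `κ`-scattered order therefore has at
most one class and is coverable; the union properties finish the proof. -/

/-- `S` contains a copy of the `n`-th lexicographic power of `T`. -/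
def ContainsPow {P : Type u} [LinearOrder P] (T : Type u) [LinearOrder T] : ℕ → Set P → Prop
  | 0, S => S.Nonempty
  | n + 1, S => ∃ A : T → Set P, (∀ s t, s < t → ∀ x ∈ A s, ∀ y ∈ A t, x < y) ∧
      ∀ t, A t ⊆ S ∧ ContainsPow T n (A t)

/-- Every coloring of `T` by `ι` is constant on a copy of `T`. -/
def Indivisible (ι T : Type u) [LinearOrder T] : Prop :=
  ∀ c : T → ι, ∃ i, ∃ g : T → T, StrictMono g ∧ ∀ t, c (g t) = i

/-! ### Powers inside a set, its pieces and its fibers. -/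

section ContainsPow

variable {P T : Type u} [LinearOrder P] [LinearOrder T]

theorem ContainsPow.mono {n : ℕ} {S S' : Set P} (h : ContainsPow T n S) (hS : S ⊆ S') :
    ContainsPow T n S' := by
  cases n with
  | zero => exact Set.Nonempty.mono hS h
  | succ n =>
    obtain ⟨A, hA, hA'⟩ := h
    exact ⟨A, hA, fun t => ⟨(hA' t).1.trans hS, (hA' t).2⟩⟩

theorem ContainsPow.of_succ [Nonempty T] {n : ℕ} {S : Set P} (h : ContainsPow T (n + 1) S) :
    ContainsPow T n S := by
  obtain ⟨A, -, hA'⟩ := h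
  obtain ⟨t⟩ := ‹Nonempty T›
  exact (hA' t).2.mono (hA' t).1

theorem ContainsPow.of_le [Nonempty T] {m n : ℕ} (hmn : m ≤ n) {S : Set P}
    (h : ContainsPow T n S) : ContainsPow T m S := by
  induction n, hmn using Nat.le_induction with
  | base => exact h
  | succ n _ ih => exact ih h.of_succ

theorem ContainsPow.nonempty [Nonempty T] {n : ℕ} {S : Set P} (h : ContainsPow T n S) :
    S.Nonempty :=
  ContainsPow.of_le (Nat.zero_le n) h

theorem not_containsPow_of_subsingleton [Nontrivial T] {n : ℕ} {S : Set P}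
    (hS : S.Subsingleton) : ¬ ContainsPow T (n + 1) S := by
  rintro ⟨A, hA, hA'⟩
  obtain ⟨s, t, hst⟩ := exists_pair_lt T
  obtain ⟨x, hx⟩ := (hA' s).2.nonempty
  obtain ⟨y, hy⟩ := (hA' t).2.nonempty
  exact (hA s t hst x hx y hy).ne (hS ((hA' s).1 hx) ((hA' t).1 hy))

theorem ContainsPow.dual {n : ℕ} {S : Set P} (h : ContainsPow T n S) :
    ContainsPow (P := Pᵒᵈ) Tᵒᵈ n (OrderDual.ofDual ⁻¹' S) := by
  induction n generalizing S with
  | zero => exact h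
  | succ n ih =>
    obtain ⟨A, hA, hA'⟩ := h
    exact ⟨fun t => OrderDual.ofDual ⁻¹' A (OrderDual.ofDual t),
      fun s t hst x hx y hy => hA _ _ hst _ hy _ hx,
      fun t => ⟨preimage_mono (hA' _).1, ih (hA' _).2⟩⟩

theorem ContainsPow.preimage {X : Type u} [LinearOrder X] (e : X ↪o P) {n : ℕ} {S : Set P}
    (h : ContainsPow T n S) (hS : S ⊆ range e) : ContainsPow T n (e ⁻¹' S) := by
  induction n generalizing S with
  | zero =>
    obtain ⟨x, hx⟩ := h
    obtain ⟨y, rfl⟩ := hS hx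
    exact ⟨y, hx⟩
  | succ n ih =>
    obtain ⟨A, hA, hA'⟩ := h
    exact ⟨fun t => e ⁻¹' A t, fun s t hst x hx y hy => e.lt_iff_lt.1 (hA s t hst _ hx _ hy),
      fun t => ⟨preimage_mono (hA' t).1, ih (hA' t).2 ((hA' t).1.trans hS)⟩⟩

theorem ContainsPow.of_type_le {n : ℕ} {S : Set P}
    (h : OrderType.type T ^ n ≤ OrderType.type S) : ContainsPow T n S := by
  induction n generalizing S with
  | zero =>
    rw [pow_zero] at h
    obtain ⟨e⟩ := (OrderType.type_le_type_iff (α := PUnit)).1 h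
    exact ⟨e PUnit.unit, (e PUnit.unit).2⟩
  | succ n ih =>
    have hX := OrderType.type_toType (OrderType.type T ^ n)
    set X := (OrderType.type T ^ n).ToType
    have h' : OrderType.type (T ×ₗ X) ≤ OrderType.type S := by
      rw [OrderType.type_lex_prod, hX]
      rwa [pow_succ] at h
    obtain ⟨e⟩ := OrderType.type_le_type_iff.1 h'
    refine ⟨fun t => range fun x : X => (e (toLex (t, x)) : P), ?_, fun t => ⟨?_, ih ?_⟩⟩
    · rintro s t hst _ ⟨x, rfl⟩ _ ⟨y, rfl⟩
      exact e.strictMono (Prod.Lex.toLex_lt_toLex.2 (Or.inl hst))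
    · rintro _ ⟨x, rfl⟩
      exact (e _).2
    · refine hX.symm.le.trans ?_
      refine OrderEmbedding.type_le_type (OrderEmbedding.ofStrictMono
        (fun x => ⟨(e (toLex (t, x)) : P), x, rfl⟩) fun x y hxy => ?_)
      exact e.strictMono (Prod.Lex.toLex_lt_toLex.2 (Or.inr ⟨rfl, hxy⟩))

/-- Color each block of the top level by a piece that captures its lower power, then pass to a
monochromatic copy of `T`. -/
theorem ContainsPow.exists_of_iUnion {ι : Type u} (hT : Indivisible ι T) [Nonempty T]
    {n : ℕ} {S : ι → Set P} (h : ContainsPow T n (⋃ i, S i)) : ∃ i, ContainsPow T n (S i) := by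
  induction n generalizing S with
  | zero =>
    obtain ⟨x, hx⟩ := h
    obtain ⟨i, hi⟩ := mem_iUnion.1 hx
    exact ⟨i, x, hi⟩
  | succ n ih =>
    obtain ⟨A, hA, hA'⟩ := h
    have hc : ∀ t, ∃ i, ContainsPow T n (A t ∩ S i) := fun t =>
      ih ((hA' t).2.mono (by rw [← inter_iUnion]; exact subset_inter subset_rfl (hA' t).1))
    choose c hc using hc
    obtain ⟨i, g, hg, hi⟩ := hT c
    exact ⟨i, fun t => A (g t) ∩ S i,
      fun s t hst x hx y hy => hA _ _ (hg hst) x hx.1 y hy.1,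
      fun t => ⟨inter_subset_right, hi t ▸ hc (g t)⟩⟩

/-- A block lying below one where `f` attains its least value must have `f` constant. -/
theorem ContainsPow.exists_fiber_of_noMinOrder [NoMinOrder T] [Nonempty T] {W : Type u}
    [LinearOrder W] [WellFoundedLT W] {f : P → W} {n : ℕ} {S : Set P} (hf : MonotoneOn f S)
    (h : ContainsPow T (n + 1) S) : ∃ w, ContainsPow T n (S ∩ f ⁻¹' {w}) := by
  obtain ⟨A, hA, hA'⟩ := h
  have hne : (f '' ⋃ t, A t).Nonempty := by
    obtain ⟨t⟩ := ‹Nonempty T›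
    exact ((hA' t).2.nonempty.mono (subset_iUnion A t)).image f
  obtain ⟨_, ⟨x, hx, rfl⟩, hmin⟩ := WellFounded.has_min (wellFounded_lt (α := W)) _ hne
  obtain ⟨t, ht⟩ := mem_iUnion.1 hx
  obtain ⟨s, hs⟩ := exists_lt t
  refine ⟨f x, (hA' s).2.mono fun y hy => ⟨(hA' s).1 hy, le_antisymm ?_ ?_⟩⟩
  · exact hf ((hA' s).1 hy) ((hA' t).1 ht) (hA s t hs y hy x ht).le
  · exact not_lt.1 (hmin _ ⟨y, mem_iUnion.2 ⟨s, hy⟩, rfl⟩)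

/-- Otherwise `f` is nonconstant on every second-level block. Along one top-level block it then
takes `μ` increasing values, all bounded by a value on a later block, while proper initial segments
of `μ` have fewer than `μ` elements. This is why two levels are lost. -/
theorem ContainsPow.exists_fiber_of_ord {μ : Cardinal.{u}} (hμ : ℵ₀ ≤ μ)
    {f : P → μ.ord.ToType} {n : ℕ} {S : Set P} (hf : MonotoneOn f S)
    (h : ContainsPow μ.ord.ToType (n + 2) S) :
    ∃ w, ContainsPow μ.ord.ToType n (S ∩ f ⁻¹' {w}) := by
  have := Cardinal.noMaxOrder hμ
  have : Nonempty μ.ord.ToType := by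
    rw [← mk_ne_zero_iff, mk_ord_toType]
    exact (aleph0_pos.trans_le hμ).ne'
  by_contra! hcon
  obtain ⟨A, hA, hA'⟩ := h
  choose hAS B hB hB' using hA'
  have hpq : ∀ t s, ∃ p ∈ B t s, ∃ q ∈ B t s, f p < f q := by
    intro t s
    by_contra! hle
    obtain ⟨x, hx⟩ := (hB' t s).2.nonempty
    exact hcon (f x) ((hB' t s).2.mono fun y hy =>
      ⟨hAS t ((hB' t s).1 hy), le_antisymm (hle x hx y hy) (hle y hy x hx)⟩)
  choose p hp q hq hlt using hpq
  have hBS : ∀ t s, B t s ⊆ S := fun t s => (hB' t s).1.trans (hAS t)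
  obtain ⟨t⟩ := ‹Nonempty μ.ord.ToType›
  obtain ⟨t', ht'⟩ := exists_gt t
  have hmono : StrictMono fun s => f (q t s) := fun s s' hss =>
    (hf (hBS _ _ (hq t s)) (hBS _ _ (hp t s'))
      (hB t s s' hss _ (hq t s) _ (hp t s')).le).trans_lt (hlt t s')
  have hbound : ∀ s, f (q t s) < f (q t' t) := fun s =>
    (hf (hBS _ _ (hq t s)) (hBS _ _ (hp t' t))
      (hA t t' ht' _ ((hB' t s).1 (hq t s)) _ ((hB' t' t).1 (hp t' t))).le).trans_lt (hlt t' t)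
  have hcard : #μ.ord.ToType ≤ #(Iio (f (q t' t))) :=
    mk_le_of_injective (f := fun s => ⟨f (q t s), hbound s⟩)
      fun a b hab => hmono.injective (congrArg Subtype.val hab)
  rw [mk_ord_toType] at hcard
  exact hcard.not_gt (by simpa using mk_Iio_lt (f (q t' t)))

end ContainsPow

/-! ### Indivisibility of regular cardinals and of their products. -/

section Indivisible

variable {ι : Type u}

theorem Indivisible.dual {T : Type u} [LinearOrder T] (h : Indivisible ι T) :
    Indivisible ι Tᵒᵈ := fun c =>
  let ⟨i, g, hg, hi⟩ := h c
  ⟨i, g, fun _ _ hst => hg hst, hi⟩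

theorem Indivisible.prodLex {A B : Type u} [LinearOrder A] [LinearOrder B]
    (hA : Indivisible ι A) (hB : Indivisible ι B) : Indivisible ι (A ×ₗ B) := by
  intro c
  -- Make each column monochromatic first, then color the columns by their colors.
  choose i g hg hi using fun a => hB fun b => c (toLex (a, b))
  obtain ⟨j, k, hk, hj⟩ := hA i
  refine ⟨j, fun x => toLex (k (ofLex x).1, g (k (ofLex x).1) (ofLex x).2), ?_,
    fun x => (hi _ _).trans (hj _)⟩
  intro x y hxy
  rcases Prod.Lex.lt_iff.1 hxy with h | ⟨h, h'⟩
  · exact Prod.Lex.toLex_lt_toLex.2 (Or.inl (hk h))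
  · refine Prod.Lex.toLex_lt_toLex.2 (Or.inr ⟨congrArg k h, ?_⟩)
    rw [h]
    exact hg _ h'

theorem indivisible_ord {μ : Cardinal.{u}} (hμ : μ.IsRegular) (hι : #ι < μ) :
    Indivisible ι μ.ord.ToType := by
  intro c
  obtain ⟨i, hi⟩ := infinite_pigeonhole_card c μ (by rw [mk_ord_toType]) hμ.aleph0_le
    (by rwa [hμ.cof_ord])
  have hle : Ordinal.type (α := μ.ord.ToType) (· < ·) ≤
      Ordinal.type (α := (c ⁻¹' {i} : Set _)) (· < ·) := by
    rw [Ordinal.type_toType, ord_le, Ordinal.card_type]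
    exact hi
  obtain ⟨e⟩ := Ordinal.type_le_iff'.1 hle
  exact ⟨i, fun t => (e t).1, fun s t hst => e.map_rel_iff.2 hst, fun t => (e t).2⟩

end Indivisible

/-! ### Sets avoiding the four powers. -/

section Good

variable {P : Type u} [LinearOrder P]

/-- `S` contains none of `μ ^ n`, `(κ * κ*) ^ n` and their reverses. -/
def AvoidsPow (κ μ : Cardinal.{u}) (n : ℕ) (S : Set P) : Prop :=
  ¬ ContainsPow μ.ord.ToType n S ∧ ¬ ContainsPow μ.ord.ToTypeᵒᵈ n S ∧
    ¬ ContainsPow (κ.ord.ToTypeᵒᵈ ×ₗ κ.ord.ToType) n S ∧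
    ¬ ContainsPow (κ.ord.ToType ×ₗ κ.ord.ToTypeᵒᵈ) n S

/-- `S` is covered by sets `Q n` such that `Q n` avoids the `n`-th powers. -/
def HasAvoidingCover (κ μ : Cardinal.{u}) (S : Set P) : Prop :=
  ∃ Q : ℕ → Set P, S ⊆ ⋃ n, Q n ∧ ∀ n, AvoidsPow κ μ n (Q n)

variable {κ μ : Cardinal.{u}}

theorem AvoidsPow.anti {n : ℕ} {S S' : Set P} (h : AvoidsPow κ μ n S') (hS : S ⊆ S') :
    AvoidsPow κ μ n S :=
  ⟨fun h' => h.1 (h'.mono hS), fun h' => h.2.1 (h'.mono hS), fun h' => h.2.2.1 (h'.mono hS),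
    fun h' => h.2.2.2 (h'.mono hS)⟩

theorem nontrivial_ord_toType (hκ : ℵ₀ ≤ κ) : Nontrivial κ.ord.ToType := by
  rw [← one_lt_iff_nontrivial, mk_ord_toType]
  exact one_lt_aleph0.trans_le hκ

theorem AvoidsPow.of_le (hκ : ℵ₀ ≤ κ) (hμ : ℵ₀ ≤ μ) {m n : ℕ} (hmn : m ≤ n) {S : Set P}
    (h : AvoidsPow κ μ m S) : AvoidsPow κ μ n S := by
  have := nontrivial_ord_toType hκ
  have := nontrivial_ord_toType hμ
  have : Nonempty (κ.ord.ToTypeᵒᵈ ×ₗ κ.ord.ToType) := inferInstanceAs (Nonempty (_ × _))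
  have : Nonempty (κ.ord.ToType ×ₗ κ.ord.ToTypeᵒᵈ) := inferInstanceAs (Nonempty (_ × _))
  exact ⟨fun h' => h.1 (h'.of_le hmn), fun h' => h.2.1 (h'.of_le hmn),
    fun h' => h.2.2.1 (h'.of_le hmn), fun h' => h.2.2.2 (h'.of_le hmn)⟩

theorem avoidsPow_empty (hκ : ℵ₀ ≤ κ) (hμ : ℵ₀ ≤ μ) (n : ℕ) :
    AvoidsPow κ μ n (∅ : Set P) :=
  AvoidsPow.of_le hκ hμ (Nat.zero_le n) ⟨not_nonempty_empty, not_nonempty_empty,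
    not_nonempty_empty, not_nonempty_empty⟩

theorem avoidsPow_succ_of_subsingleton (hκ : ℵ₀ ≤ κ) (hμ : ℵ₀ ≤ μ) (n : ℕ) {S : Set P}
    (hS : S.Subsingleton) : AvoidsPow κ μ (n + 1) S := by
  have := nontrivial_ord_toType hκ
  have := nontrivial_ord_toType hμ
  have : Nontrivial (κ.ord.ToTypeᵒᵈ ×ₗ κ.ord.ToType) := inferInstanceAs (Nontrivial (_ × _))
  have : Nontrivial (κ.ord.ToType ×ₗ κ.ord.ToTypeᵒᵈ) := inferInstanceAs (Nontrivial (_ × _))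
  exact ⟨not_containsPow_of_subsingleton hS, not_containsPow_of_subsingleton hS,
    not_containsPow_of_subsingleton hS, not_containsPow_of_subsingleton hS⟩

theorem AvoidsPow.iUnion (hκ : κ.IsRegular) (hμ : μ.IsRegular) (hκμ : κ ≤ μ) {ι : Type u}
    (hι : #ι < κ) {n : ℕ} {S : ι → Set P} (h : ∀ i, AvoidsPow κ μ n (S i)) :
    AvoidsPow κ μ n (⋃ i, S i) := by
  have := nontrivial_ord_toType hκ.aleph0_le
  have := nontrivial_ord_toType hμ.aleph0_le
  have : Nonempty (κ.ord.ToTypeᵒᵈ ×ₗ κ.ord.ToType) := inferInstanceAs (Nonempty (_ × _))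
  have : Nonempty (κ.ord.ToType ×ₗ κ.ord.ToTypeᵒᵈ) := inferInstanceAs (Nonempty (_ × _))
  have hiκ := indivisible_ord hκ hι
  have hiμ := indivisible_ord hμ (hι.trans_le hκμ)
  refine ⟨fun h' => ?_, fun h' => ?_, fun h' => ?_, fun h' => ?_⟩
  · obtain ⟨i, hi⟩ := h'.exists_of_iUnion hiμ
    exact (h i).1 hi
  · obtain ⟨i, hi⟩ := h'.exists_of_iUnion hiμ.dual
    exact (h i).2.1 hi
  · obtain ⟨i, hi⟩ := h'.exists_of_iUnion (hiκ.dual.prodLex hiκ)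
    exact (h i).2.2.1 hi
  · obtain ⟨i, hi⟩ := h'.exists_of_iUnion (hiκ.prodLex hiκ.dual)
    exact (h i).2.2.2 hi

/-- The reversal of `A ×ₗ B` is the lexicographic product of the reversals. -/
def dualProdLex (A B : Type u) [LinearOrder A] [LinearOrder B] :
    (A ×ₗ B)ᵒᵈ ≃o Aᵒᵈ ×ₗ Bᵒᵈ where
  toFun x := toLex (ofLex (OrderDual.ofDual x))
  invFun x := OrderDual.toDual (toLex (ofLex x))
  left_inv _ := rfl
  right_inv _ := rfl
  map_rel_iff' {x y} := by
    change toLex (α := Aᵒᵈ × Bᵒᵈ) (ofLex (OrderDual.ofDual x)) ≤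
      toLex (α := Aᵒᵈ × Bᵒᵈ) (ofLex (OrderDual.ofDual y)) ↔
      OrderDual.ofDual y ≤ OrderDual.ofDual x
    rw [Prod.Lex.toLex_le_toLex, Prod.Lex.le_iff]
    exact or_congr Iff.rfl (and_congr_left' eq_comm)

theorem ContainsPow.of_orderIso {T T' : Type u} [LinearOrder T] [LinearOrder T'] (e : T ≃o T')
    {n : ℕ} {S : Set P} (h : ContainsPow T n S) : ContainsPow T' n S := by
  induction n generalizing S with
  | zero => exact h
  | succ n ih =>
    obtain ⟨A, hA, hA'⟩ := h
    exact ⟨fun t => A (e.symm t), fun s t hst => hA _ _ (e.symm.strictMono hst),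
      fun t => ⟨(hA' _).1, ih (hA' _).2⟩⟩

theorem AvoidsPow.dual {n : ℕ} {S : Set P} (h : AvoidsPow κ μ n S) :
    AvoidsPow (P := Pᵒᵈ) κ μ n (OrderDual.ofDual ⁻¹' S) :=
  ⟨fun h' => h.2.1 h'.dual, fun h' => h.1 h'.dual,
    fun h' => h.2.2.2 (ContainsPow.dual h' |>.of_orderIso (dualProdLex _ _)),
    fun h' => h.2.2.1 (ContainsPow.dual h' |>.of_orderIso (dualProdLex _ _))⟩

/-- Only `μ` itself needs the two lost levels: its reverse and both products have no least element,
so one level suffices for them. -/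
theorem AvoidsPow.of_monotoneOn (hκ : ℵ₀ ≤ κ) (hμ : ℵ₀ ≤ μ) {n : ℕ} {S : Set P}
    {f : P → μ.ord.ToType} (hf : MonotoneOn f S)
    (h : ∀ w, AvoidsPow κ μ n (S ∩ f ⁻¹' {w})) : AvoidsPow κ μ (n + 2) S := by
  have := nontrivial_ord_toType hκ
  have := nontrivial_ord_toType hμ
  have := Cardinal.noMaxOrder hκ
  have := Cardinal.noMaxOrder hμ
  have : Nonempty (κ.ord.ToTypeᵒᵈ ×ₗ κ.ord.ToType) := inferInstanceAs (Nonempty (_ × _))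
  have : Nonempty (κ.ord.ToType ×ₗ κ.ord.ToTypeᵒᵈ) := inferInstanceAs (Nonempty (_ × _))
  refine ⟨fun h' => ?_, fun h' => ?_, fun h' => ?_, fun h' => ?_⟩
  · obtain ⟨w, hw⟩ := h'.exists_fiber_of_ord hμ hf
    exact (h w).1 hw
  · obtain ⟨w, hw⟩ := h'.of_succ.exists_fiber_of_noMinOrder hf
    exact (h w).2.1 hw
  · obtain ⟨w, hw⟩ := h'.of_succ.exists_fiber_of_noMinOrder hf
    exact (h w).2.2.1 hw
  · obtain ⟨w, hw⟩ := h'.of_succ.exists_fiber_of_noMinOrder hf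
    exact (h w).2.2.2 hw

theorem AvoidsPow.of_antitoneOn (hκ : ℵ₀ ≤ κ) (hμ : ℵ₀ ≤ μ) {n : ℕ} {S : Set P}
    {f : P → μ.ord.ToType} (hf : AntitoneOn f S)
    (h : ∀ w, AvoidsPow κ μ n (S ∩ f ⁻¹' {w})) : AvoidsPow κ μ (n + 2) S :=
  AvoidsPow.dual (P := Pᵒᵈ) (AvoidsPow.of_monotoneOn (P := Pᵒᵈ) (f := f ∘ OrderDual.ofDual)
    hκ hμ (fun _ hx _ hy hxy => hf hy hx hxy) fun w => (h w).dual)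

/-! ### Closure properties of coverable sets. -/

theorem HasAvoidingCover.anti {S S' : Set P} (h : HasAvoidingCover κ μ S') (hS : S ⊆ S') :
    HasAvoidingCover κ μ S :=
  let ⟨Q, hQ, hQ'⟩ := h
  ⟨Q, hS.trans hQ, hQ'⟩

theorem hasAvoidingCover_of_subsingleton (hκ : ℵ₀ ≤ κ) (hμ : ℵ₀ ≤ μ) {S : Set P}
    (hS : S.Subsingleton) : HasAvoidingCover κ μ S := by
  -- A zeroth power is a single point, so the set with index 0 must be empty.
  refine ⟨fun n => Nat.casesOn n ∅ fun _ => S, fun x hx => mem_iUnion.2 ⟨1, hx⟩, fun n => ?_⟩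
  cases n with
  | zero => exact avoidsPow_empty hκ hμ 0
  | succ n => exact avoidsPow_succ_of_subsingleton hκ hμ n hS

theorem HasAvoidingCover.iUnion (hκ : κ.IsRegular) (hμ : μ.IsRegular) (hκμ : κ ≤ μ)
    {ι : Type u} (hι : #ι < κ) {S : ι → Set P} (h : ∀ i, HasAvoidingCover κ μ (S i)) :
    HasAvoidingCover κ μ (⋃ i, S i) := by
  choose Q hQ hQ' using h
  refine ⟨fun n => ⋃ i, Q i n, iUnion_subset fun i x hx => ?_,
    fun n => AvoidsPow.iUnion hκ hμ hκμ hι fun i => hQ' i n⟩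
  obtain ⟨n, hn⟩ := mem_iUnion.1 (hQ i hx)
  exact mem_iUnion.2 ⟨n, mem_iUnion.2 ⟨i, hn⟩⟩

theorem HasAvoidingCover.iUnion_nat (hκ : ℵ₀ ≤ κ) (hμ : ℵ₀ ≤ μ) {S : ℕ → Set P}
    (h : ∀ i, HasAvoidingCover κ μ (S i)) : HasAvoidingCover κ μ (⋃ i, S i) := by
  choose Q hQ hQ' using h
  -- The index `Nat.pair i m` is at least `m`, and avoiding `m`-th powers implies avoiding all
  -- higher ones.
  refine ⟨fun n => Q n.unpair.1 n.unpair.2, iUnion_subset fun i x hx => ?_,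
    fun n => (hQ' _ _).of_le hκ hμ (Nat.unpair_right_le n)⟩
  obtain ⟨n, hn⟩ := mem_iUnion.1 (hQ i hx)
  exact mem_iUnion.2 ⟨Nat.pair i n, by simpa using hn⟩

theorem HasAvoidingCover.iUnion_of_lt (hκ : κ.IsRegular) (hμ : μ.IsRegular) (hκμ : κ ≤ μ)
    {ι : Type u} (hι : #ι < max ℵ₁ κ) {S : ι → Set P}
    (h : ∀ i, HasAvoidingCover κ μ (S i)) : HasAvoidingCover κ μ (⋃ i, S i) := by
  rcases lt_max_iff.1 hι with hι | hι
  · have : Countable ι := mk_le_aleph0_iff.1 (lt_aleph_one_iff.1 hι)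
    rcases isEmpty_or_nonempty ι with hE | hE
    · rw [iUnion_of_empty]
      exact hasAvoidingCover_of_subsingleton hκ.aleph0_le hμ.aleph0_le subsingleton_empty
    · obtain ⟨g, hg⟩ := exists_surjective_nat ι
      rw [← hg.iUnion_comp]
      exact HasAvoidingCover.iUnion_nat hκ.aleph0_le hμ.aleph0_le fun n => h (g n)
  · exact HasAvoidingCover.iUnion hκ hμ hκμ hι h

theorem HasAvoidingCover.union (hκ : κ.IsRegular) (hμ : μ.IsRegular) (hκμ : κ ≤ μ)
    {S S' : Set P} (h : HasAvoidingCover κ μ S) (h' : HasAvoidingCover κ μ S') :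
    HasAvoidingCover κ μ (S ∪ S') := by
  have hU := HasAvoidingCover.iUnion hκ hμ hκμ (ι := ULift Bool)
    (S := fun b => cond b.down S S') ((lt_aleph0_of_finite _).trans_le hκ.aleph0_le)
    (by rintro ⟨_ | _⟩ <;> assumption)
  refine hU.anti (union_subset (fun x hx => ?_) fun x hx => ?_)
  · exact mem_iUnion.2 ⟨⟨true⟩, hx⟩
  · exact mem_iUnion.2 ⟨⟨false⟩, hx⟩

theorem HasAvoidingCover.of_fibers (hκ : ℵ₀ ≤ κ) (hμ : ℵ₀ ≤ μ) {S : Set P}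
    {f : P → μ.ord.ToType} (hf : MonotoneOn f S ∨ AntitoneOn f S)
    (h : ∀ w, HasAvoidingCover κ μ (S ∩ f ⁻¹' {w})) : HasAvoidingCover κ μ S := by
  choose Q hQ hQ' using h
  set R : ℕ → Set P := fun n => {x ∈ S | x ∈ Q (f x) n} with hR
  have hRf : ∀ n w, AvoidsPow κ μ n (R n ∩ f ⁻¹' {w}) := fun n w =>
    (hQ' w n).anti (by rintro x ⟨⟨-, hx⟩, rfl⟩; exact hx)
  have hRS : ∀ n, R n ⊆ S := fun n x hx => hx.1
  -- `R n` is placed at index `n + 2` to pay for the two lost levels.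
  refine ⟨fun n => Nat.casesOn n ∅ fun n => Nat.casesOn n ∅ R, fun x hx => ?_, fun n => ?_⟩
  · obtain ⟨n, hn⟩ := mem_iUnion.1 (hQ (f x) ⟨hx, rfl⟩)
    exact mem_iUnion.2 ⟨n + 2, hx, hn⟩
  · match n with
    | 0 => exact avoidsPow_empty hκ hμ 0
    | 1 => exact avoidsPow_empty hκ hμ 1
    | n + 2 =>
      rcases hf with hf | hf
      · exact AvoidsPow.of_monotoneOn hκ hμ (hf.mono (hRS n)) (hRf n)
      · exact AvoidsPow.of_antitoneOn hκ hμ (hf.mono (hRS n)) (hRf n)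

theorem HasAvoidingCover.image {X : Type u} [LinearOrder X] (e : X ↪o P) {S : Set X}
    (h : HasAvoidingCover κ μ S) : HasAvoidingCover κ μ (e '' S) := by
  obtain ⟨Q, hQ, hQ'⟩ := h
  refine ⟨fun n => e '' Q n, by rw [← image_iUnion]; exact image_mono hQ, fun n => ?_⟩
  have key : ∀ (T : Type u) [LinearOrder T], ContainsPow T n (e '' Q n) → ContainsPow T n (Q n) := by
    intro T _ h
    have := h.preimage e (image_subset_range _ _)
    rwa [preimage_image_eq _ e.injective] at this
  exact ⟨fun h => (hQ' n).1 (key _ h), fun h => (hQ' n).2.1 (key _ h),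
    fun h => (hQ' n).2.2.1 (key _ h), fun h => (hQ' n).2.2.2 (key _ h)⟩

/-- Covers of initial pieces of a set amalgamate to a cover of the set. -/
theorem HasAvoidingCover.of_forall_inter_Iic (hκ : ℵ₀ ≤ κ) (hμ : ℵ₀ ≤ μ) (hP : #P ≤ μ)
    {S : Set P} (h : ∀ y ∈ S, HasAvoidingCover κ μ (S ∩ Iic y)) : HasAvoidingCover κ μ S := by
  have := nontrivial_ord_toType hμ
  rw [← mk_ord_toType μ] at hP
  obtain ⟨g⟩ := hP
  -- With `P` injected into `μ` by `g`, `f x` is the least label of a point of `S` above `x`. It is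
  -- monotone in `x`, and its fiber over the label of `y` lies below `y`.
  have hf : ∀ x ∈ S, ∃ w, IsLeast (g '' (S ∩ Ici x)) w := fun x hx =>
    let ⟨w, hw, hmin⟩ := WellFounded.has_min (wellFounded_lt (α := μ.ord.ToType))
      (g '' (S ∩ Ici x)) ⟨_, x, ⟨hx, le_rfl⟩, rfl⟩
    ⟨w, hw, fun v hv => not_lt.1 (hmin v hv)⟩
  choose! f hf using hf
  refine of_fibers hκ hμ (f := f) (Or.inl fun x hx y hy hxy => (hf x hx).2 ?_) fun w => ?_
  · obtain ⟨z, hz, hzw⟩ := (hf y hy).1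
    exact ⟨z, ⟨hz.1, hxy.trans hz.2⟩, hzw⟩
  · by_cases hw : ∃ y ∈ S, g y = w
    · obtain ⟨y, hy, rfl⟩ := hw
      refine (h y hy).anti fun x hx => ⟨hx.1, ?_⟩
      obtain ⟨z, hz, hzw⟩ := (hf x hx.1).1
      have hzy : z = y := g.injective (hzw.trans hx.2)
      exact hzy ▸ hz.2
    · refine (hasAvoidingCover_of_subsingleton hκ hμ subsingleton_empty).anti fun x hx => hw ?_
      obtain ⟨z, hz, hzw⟩ := (hf x hx.1).1
      exact ⟨z, hz.1, hzw.trans hx.2⟩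

theorem HasAvoidingCover.dual {S : Set P} (h : HasAvoidingCover κ μ S) :
    HasAvoidingCover (P := Pᵒᵈ) κ μ (OrderDual.ofDual ⁻¹' S) :=
  let ⟨Q, hQ, hQ'⟩ := h
  ⟨fun n => OrderDual.ofDual ⁻¹' Q n, by rw [← preimage_iUnion]; exact preimage_mono hQ,
    fun n => (hQ' n).dual⟩

theorem HasAvoidingCover.of_forall_inter_Ici (hκ : ℵ₀ ≤ κ) (hμ : ℵ₀ ≤ μ) (hP : #P ≤ μ)
    {S : Set P} (h : ∀ y ∈ S, HasAvoidingCover κ μ (S ∩ Ici y)) : HasAvoidingCover κ μ S :=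
  HasAvoidingCover.dual (P := Pᵒᵈ) (HasAvoidingCover.of_forall_inter_Iic (P := Pᵒᵈ) hκ hμ hP
    fun y hy => (h y hy).dual)

/-- Identifies two points when the interval between them has an avoiding cover. -/
def avoidingSetoid (P : Type u) [LinearOrder P] (hκ : κ.IsRegular) (hμ : μ.IsRegular)
    (hκμ : κ ≤ μ) : Setoid P where
  r a b := HasAvoidingCover κ μ (uIcc a b)
  iseqv :=
    { refl := fun a => hasAvoidingCover_of_subsingleton hκ.aleph0_le hμ.aleph0_le (by simp)
      symm := fun {a b} h => by rwa [uIcc_comm]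
      trans := fun {a b c} h h' => (h.union hκ hμ hκμ h').anti uIcc_subset_uIcc_union_uIcc }

/-- Cut the class at `a`: each initial piece of the upper half, and each final piece of the lower
half, lies in a coverable interval ending at `a`. -/
theorem hasAvoidingCover_class (hκ : κ.IsRegular) (hμ : μ.IsRegular) (hκμ : κ ≤ μ)
    (hP : #P ≤ μ) (a : P) : HasAvoidingCover κ μ {x | HasAvoidingCover κ μ (uIcc a x)} := by
  have h1 : HasAvoidingCover κ μ ({x | HasAvoidingCover κ μ (uIcc a x)} ∩ Ici a) :=
    HasAvoidingCover.of_forall_inter_Iic hκ.aleph0_le hμ.aleph0_le hP fun y hy =>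
      HasAvoidingCover.anti hy.1 fun x hx => by
        rw [uIcc_of_le hy.2]
        exact ⟨hx.1.2, hx.2⟩
  have h2 : HasAvoidingCover κ μ ({x | HasAvoidingCover κ μ (uIcc a x)} ∩ Iic a) :=
    HasAvoidingCover.of_forall_inter_Ici hκ.aleph0_le hμ.aleph0_le hP fun y hy =>
      HasAvoidingCover.anti hy.1 fun x hx => by
        rw [uIcc_of_ge hy.2]
        exact ⟨hx.2, hx.1.2⟩
  refine (h1.union hκ hμ hκμ h2).anti fun x hx => ?_
  rcases le_total a x with h | h
  · exact Or.inl ⟨hx, h⟩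
  · exact Or.inr ⟨hx, h⟩

theorem hasAvoidingCover_univ_of_isKScattered (hκ : κ.IsRegular) (hμ : μ.IsRegular)
    (hκμ : κ ≤ μ) (hP : #P ≤ μ) (hs : OrderType.IsKScattered κ (OrderType.type P)) :
    HasAvoidingCover κ μ (univ : Set P) := by
  let r := avoidingSetoid P hκ hμ hκμ
  let D : Set P := range (Quotient.out : Quotient r → P)
  have hout : ∀ x : P, HasAvoidingCover κ μ (uIcc (Quotient.mk r x).out x) := fun x =>
    Quotient.exact (s := r) (Quotient.out_eq _)
  have hdisj : ∀ a b : D, HasAvoidingCover κ μ (uIcc (a : P) b) → a = b := by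
    rintro ⟨_, p, rfl⟩ ⟨_, q, rfl⟩ h
    have hpq : Quotient.mk r p.out = Quotient.mk r q.out := Quotient.sound h
    rw [Quotient.out_eq, Quotient.out_eq] at hpq
    subst hpq
    rfl
  by_cases hD : 1 < #D
  · refine (hs ⟨OrderType.type D, ⟨D, inferInstance, rfl, hD, fun a b hab => ?_⟩,
      (OrderEmbedding.subtype (· ∈ D)).type_le_type⟩).elim
    by_contra! hlt
    -- The classes of `a`, of `b` and of the fewer than `κ` representatives between them cover the
    -- interval from `a` to `b`. A point of it whose representative is outside belongs to the class
    -- of `a` or of `b`, since that endpoint lies between the two.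
    have hU := HasAvoidingCover.iUnion hκ hμ hκμ hlt
      (S := fun d : Ioo a b => {x | HasAvoidingCover κ μ (uIcc (d.1 : P) x)})
      fun d => hasAvoidingCover_class hκ hμ hκμ hP _
    have hU' := (hU.union hκ hμ hκμ (hasAvoidingCover_class hκ hμ hκμ hP (a : P))).union
      hκ hμ hκμ (hasAvoidingCover_class hκ hμ hκμ hP (b : P))
    refine hab.ne (hdisj a b (hU'.anti fun x hx => ?_))
    rw [uIcc_of_le (Subtype.coe_le_coe.2 hab.le)] at hx
    have hx' := hout x
    set d : D := ⟨(Quotient.mk r x).out, mem_range_self _⟩ with hd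
    change HasAvoidingCover κ μ (uIcc (d : P) x) at hx'
    rcases le_or_gt d a with hda | hda
    · refine Or.inl (Or.inr (hx'.anti (uIcc_subset_uIcc ?_ right_mem_uIcc)))
      exact Icc_subset_uIcc ⟨hda, hx.1⟩
    · rcases le_or_gt b d with hdb | hdb
      · refine Or.inr (hx'.anti (uIcc_subset_uIcc ?_ right_mem_uIcc))
        exact Icc_subset_uIcc' ⟨hx.2, hdb⟩
      · exact Or.inl (Or.inl (mem_iUnion.2 ⟨⟨d, hda, hdb⟩, hx'⟩))
  · have hsub : Subsingleton D := by rwa [← le_one_iff_subsingleton, ← not_lt]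
    rcases isEmpty_or_nonempty P with hE | ⟨⟨a⟩⟩
    · exact hasAvoidingCover_of_subsingleton hκ.aleph0_le hμ.aleph0_le
        fun x => (hE.false x).elim
    · refine (hasAvoidingCover_class hκ hμ hκμ hP (Quotient.mk r a).out).anti fun x _ => ?_
      have hxa : (Quotient.mk r x).out = (Quotient.mk r a).out :=
        congrArg Subtype.val (Subsingleton.elim (⟨_, mem_range_self _⟩ : D) ⟨_, mem_range_self _⟩)
      exact hxa ▸ hout x

end Good

/-! ### Translation from order types to lexicographic powers. -/

namespace OrderType

theorem rev_mul (φ ψ : OrderType.{u}) : (φ * ψ).rev = φ.rev * ψ.rev :=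
  inductionOn₂ φ ψ fun α _ β _ => by
    rw [rev_type, rev_type]
    exact (dualProdLex β α).type_congr

theorem rev_pow (φ : OrderType.{u}) (n : ℕ) : (φ ^ n).rev = φ.rev ^ n := by
  induction n with
  | zero => exact (OrderIso.ofUnique PUnitᵒᵈ PUnit).type_congr
  | succ n ih => rw [pow_succ, pow_succ, rev_mul, ih]

theorem ofOrdinal_type (α : Type u) [LinearOrder α] [WellFoundedLT α] :
    ofOrdinal (Ordinal.type (α := α) (· < ·)) = type α := by
  obtain ⟨e⟩ := Ordinal.type_eq.1 (Ordinal.type_toType (Ordinal.type (α := α) (· < ·)))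
  exact (OrderIso.ofRelIsoLT e).type_congr

theorem ofOrdinal_mul (a b : Ordinal.{u}) : ofOrdinal (a * b) = ofOrdinal a * ofOrdinal b := by
  have h := ofOrdinal_type (b.ToType ×ₗ a.ToType)
  have h' : Ordinal.type (α := b.ToType ×ₗ a.ToType) (· < ·) = a * b :=
    (Ordinal.type_prod_lex (α := a.ToType) (β := b.ToType) (· < ·) (· < ·)).trans
      (by rw [Ordinal.type_toType, Ordinal.type_toType])
  rw [h'] at h
  exact h

theorem ofOrdinal_pow (a : Ordinal.{u}) (n : ℕ) : ofOrdinal (a ^ n) = ofOrdinal a ^ n := by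
  induction n with
  | zero =>
    rw [pow_zero, pow_zero]
    exact (OrderIso.ofUnique (Ordinal.ToType 1) PUnit).type_congr
  | succ n ih => rw [pow_succ, pow_succ, ofOrdinal_mul, ih]

end OrderType

theorem ContainsPow.of_hasSuborder {P T : Type u} [LinearOrder P] [LinearOrder T] {n : ℕ}
    {S : Set P} (h : OrderType.HasSuborder S (OrderType.type T ^ n)) : ContainsPow T n S := by
  obtain ⟨R, hR⟩ := h
  refine ContainsPow.of_type_le ?_
  rw [← hR]
  exact (OrderEmbedding.subtype (· ∈ R)).type_le_type

theorem mainTheorem4 (κ μ : Cardinal.{u}) (hκ : κ.IsRegular) (hμ : μ.IsRegular) (hκμ : κ ≤ μ)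
    (φ : OrderType.{u}) (hφ : φ.IsPairScattered κ (max ℵ₁ κ)) (hcard : φ.card ≤ μ)
    (P : Type u) [LinearOrder P] (hP : OrderType.type P = φ) :
    ∃ Q : ℕ → Set P, (⋃ n, Q n) = Set.univ ∧ ∀ n : ℕ,
      ¬ OrderType.HasSuborder (Q n) (OrderType.ofOrdinal (μ.ord ^ n)) ∧
      ¬ OrderType.HasSuborder (Q n) (OrderType.ofOrdinal (μ.ord ^ n)).rev ∧
      ¬ OrderType.HasSuborder (Q n)
          ((OrderType.ofOrdinal κ.ord * (OrderType.ofOrdinal κ.ord).rev) ^ n) ∧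
      ¬ OrderType.HasSuborder (Q n)
          (((OrderType.ofOrdinal κ.ord).rev * OrderType.ofOrdinal κ.ord) ^ n) := by
  obtain ⟨X, _, hX, ι, Q, hι, hQ, hU⟩ := hφ
  obtain ⟨e⟩ := OrderType.type_eq_type.1 (hX.trans hP.symm)
  have hcardX : #X ≤ μ := by rwa [← hX, OrderType.card_type] at hcard
  have hcov : HasAvoidingCover κ μ (univ : Set X) := by
    rw [← hU]
    refine HasAvoidingCover.iUnion_of_lt hκ hμ hκμ hι fun i => ?_
    have h := (hasAvoidingCover_univ_of_isKScattered hκ hμ hκμ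
      ((mk_set_le _).trans hcardX) (hQ i)).image (OrderEmbedding.subtype (· ∈ Q i))
    exact h.anti fun x hx => ⟨⟨x, hx⟩, mem_univ _, rfl⟩
  obtain ⟨R, hR, hR'⟩ := hcov.image e.toOrderEmbedding
  refine ⟨R, univ_subset_iff.1 fun x _ => hR ⟨e.symm x, mem_univ _, e.apply_symm_apply x⟩,
    fun n => ⟨fun h => (hR' n).1 ?_, fun h => (hR' n).2.1 ?_, fun h => (hR' n).2.2.1 ?_,
      fun h => (hR' n).2.2.2 ?_⟩⟩
  · rw [OrderType.ofOrdinal_pow] at h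
    exact ContainsPow.of_hasSuborder h
  · rw [OrderType.ofOrdinal_pow, OrderType.rev_pow] at h
    exact ContainsPow.of_hasSuborder h
  · exact ContainsPow.of_hasSuborder h
  · exact ContainsPow.of_hasSuborder h
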